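/- Let $n\ge 1$ and $m\ge n+1$ be integers and let $A=(a_1,\dots,a_m)\in\mathbb R^{n\times m}$ satisfy $AA^\top=I_n$. For $S\subset\{1,\dots,m\}$ with $\#S=n$ let $A_S=(a_j:j\in S)\in\mathbb R^{n\times n}$ be the submatrix of the columns indexed by $S$, and let $\sigma_{\min}(A_S)=\min_{x\in\mathbb R^n,\ \|x\|_2=1}\|A_Sx\|_2$ be its smallest singular value. Put $$ \alpha=\alpha_{m,n}:=\begin{cases}\frac12+\frac12\,(1-h_1)^{1/2}&\text{if } m\ge 2n,\\[2pt] \frac12+\frac12\,(1-h_2)^{1/2}&\text{if } m\le 2n,\end{cases} $$ where $$ h_1=h_1(m,n,n)=4\cdot\frac{n-1}{n^2}\left(1-\frac{(n-1)(m-n+1)}{(m-n)\,n}\right),\qquad h_2=h_2(m,n,n)=4\cdot\frac{(m-n-1)(2n+1-m)}{(m-n)^3\,n} $$ (the two cases agree when $m=2n$). Then there exists $S_0\subset\{1,\dots,m\}$ of size $n$ such that the columns of $A_{S_0}$ form a basis of $\mathbb R^n$ and $$ \sigma_{\min}(A_{S_0})^2\ \ge\ \frac{1}{\alpha\, n\,(m-n)+1}.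 $$ Moreover, if $n\ge 2$ and $m\ge n+2$, then $0<\alpha<1$, so that this bound is strictly larger than the Hong–Pan bound: $\frac{1}{n(m-n)+1}<\frac{1}{\alpha\, n\,(m-n)+1}$. -/

import Mathlib

noncomputable section

namespace SubsetSelection

/-- The submatrix `A_S` made of the columns of `A` whose index lies in `S`. -/
def colSubmatrix {n m : ℕ} (A : Matrix (Fin n) (Fin m) ℝ) (S : Finset (Fin m)) :
    Matrix (Fin n) S ℝ :=
  A.submatrix id (fun j : S => (j : Fin m))

/-- The smallest of the `min {#κ, #ι}` singular values of a real `ι × κ` matrix: the minimum of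
`‖M x‖₂` over Euclidean unit vectors `x` if `#κ ≤ #ι`, and of `‖Mᵀ x‖₂` otherwise.
(The infimum is over a compact sphere, so it is attained as soon as that sphere is non-empty.) -/
def sigmaMin {ι κ : Type*} [Fintype ι] [Fintype κ] [DecidableEq ι] [DecidableEq κ]
    (M : Matrix ι κ ℝ) : ℝ :=
  if Fintype.card κ ≤ Fintype.card ι then
    ⨅ x : Metric.sphere (0 : EuclideanSpace ℝ κ) 1, ‖Matrix.toEuclideanLin M x‖
  else
    ⨅ x : Metric.sphere (0 : EuclideanSpace ℝ ι) 1, ‖Matrix.toEuclideanLin M.transpose x‖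

/-- `h₁(m, x₂, x₃)`. -/
def h₁ (m x₂ x₃ : ℝ) : ℝ :=
  4 * ((x₃ - 1) / x₃ ^ 2) * (1 - (x₃ - 1) * (m - x₃ + 1) / ((m - x₂) * x₂))

/-- `h₂(m, x₂, x₃)`. -/
def h₂ (m x₂ x₃ : ℝ) : ℝ :=
  4 * ((x₂ + 1 - x₃) * (m - x₂ - 1) * (x₂ + x₃ + 1 - m) / ((m - x₃) * x₃ * (m - x₂) ^ 2))

/-- The constant `α_{m,n}`. The two cases overlap at `m = 2 n`, where they agree:
see `alpha_of_le`. -/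
def alpha (m n : ℕ) : ℝ :=
  if 2 * n ≤ m then 1 / 2 + 1 / 2 * √(1 - h₁ m n n) else 1 / 2 + 1 / 2 * √(1 - h₂ m n n)

theorem alpha_of_ge {m n : ℕ} (h : 2 * n ≤ m) :
    alpha m n = 1 / 2 + 1 / 2 * √(1 - h₁ m n n) := if_pos h

theorem alpha_of_le {m n : ℕ} (hn : 1 ≤ n) (h : m ≤ 2 * n) :
    alpha m n = 1 / 2 + 1 / 2 * √(1 - h₂ m n n) := by
  rcases h.lt_or_eq with h | rfl
  · exact if_neg (not_le.mpr h)
  · have hn' : (n : ℝ) ≠ 0 := by positivity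
    have e : h₁ ((2 * n : ℕ) : ℝ) n n = h₂ ((2 * n : ℕ) : ℝ) n n := by
      have e2 : ((2 * n : ℕ) : ℝ) - n = n := by push_cast; ring
      unfold h₁ h₂
      rw [e2]
      push_cast
      field_simp
      ring
    rw [alpha, if_pos le_rfl, e]

end SubsetSelection

end

/-!
Write `k = m - n` and `T = α n k`; the bound to be proved is `σ_min(A_S)² ≥ 1 / (1 + T)`.
With `r = min n k` and `s = max n k`, the two formulas for `α` both say that `α` is the larger root
of `α (1 - α) = (r - 1) (s - r + 1) / (r³ s)` (`alpha_spec`). A set `S` of `n` columns is good if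
`c ‖u‖² ≤ ‖A_Sᵀ u‖²` for all `u`, where `c = 1 / (1 + T)` (`FrameBound`); since `A_S` is square,
this gives the linear independence, the span and the bound on `σ_min`.

Suppose the columns in the image of `f` are a basis, and let `B` be the matrix of coefficients of
the other columns in it. As `A Aᵀ = 1`, the best frame constant is `1 / (1 + ‖B‖²)`. Choose `f` of
maximal volume, so that `B` has entries in `[-1, 1]` and `e = ‖B‖_F² ≤ n k` (`exists_maxVolume`).
If `‖B Bᵀ‖_F ≤ T`, this basis is good. Otherwise exchange one basis vector: if the exchange at the
entry `(i, j)` leads to `B'`, then by Lagrange's identity (`sum_minors_sq`)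
`∑ B i j ² ‖B'‖_F² = n k + (n + k - 2) e + 2 (e² - ‖B Bᵀ‖_F²)`,
which is at most `T e` when `‖B Bᵀ‖_F > T`, provided that `r ≥ 3` (`exchange_inequality`) or that
`r = 1`, where `α = 1`. Hence some exchange has `‖B'‖_F² ≤ T`
(`exists_frameBound_of_exchange`).

For `r = 2` the constant is sharper than this. If `n = 2`, take the longest column `a_i`, with
`‖a_i‖² ≥ 2 / m`, and sum `det (a_i a_iᵀ + a_j a_jᵀ - c)` over `j ≠ i`: the sum is non-negative
exactly because `1 / c` is the larger root of `2 x² - 4 (m - 1) x + m (m - 1)`, so that some `j`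
makes the matrix positive semidefinite (`exists_frameBound_pair`). If `k = 2`, apply this to the
orthogonal complement of the row space of `A` and pass to the complementary set of columns
(`FrameBound.compl`).
-/

namespace SubsetSelection

open Matrix Finset

/-! ### Frame bounds and smallest singular values -/

/-- The columns of `A` indexed by `S` form a frame with lower frame bound `c`:
`A_S A_Sᵀ ≥ c` as quadratic forms, that is `c ‖u‖² ≤ ‖A_Sᵀ u‖²` for every `u`. -/
def FrameBound {n m : ℕ} (A : Matrix (Fin n) (Fin m) ℝ) (c : ℝ) (S : Finset (Fin m)) : Prop :=
  ∀ u : Fin n → ℝ, c * (u ⬝ᵥ u) ≤ ∑ l ∈ S, (u ᵥ* A) l ^ 2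

theorem dotProduct_self_nonneg_real {ι : Type*} [Fintype ι] (u : ι → ℝ) : 0 ≤ u ⬝ᵥ u :=
  Finset.sum_nonneg fun i _ => mul_self_nonneg (u i)

theorem dotProduct_sq_le {ι : Type*} [Fintype ι] (u v : ι → ℝ) :
    (u ⬝ᵥ v) ^ 2 ≤ (u ⬝ᵥ u) * (v ⬝ᵥ v) := by
  simpa only [dotProduct, ← sq] using Finset.sum_mul_sq_le_sq_mul_sq Finset.univ u v

theorem vecMul_dotProduct_self_of_mul_transpose_eq_one {n m : ℕ} {A : Matrix (Fin n) (Fin m) ℝ}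
    (hA : A * Aᵀ = 1) (u : Fin n → ℝ) : (u ᵥ* A) ⬝ᵥ (u ᵥ* A) = u ⬝ᵥ u := by
  rw [← dotProduct_mulVec, ← vecMul_transpose, vecMul_vecMul, hA, vecMul_one]

/-- An upper bound for `‖Mᵀ u‖²` is one for `‖M x‖²`. -/
theorem mulVec_dotProduct_self_le {ι κ : Type*} [Fintype ι] [Fintype κ] {M : Matrix ι κ ℝ} {d : ℝ}
    (hd : 0 ≤ d) (h : ∀ u, (u ᵥ* M) ⬝ᵥ (u ᵥ* M) ≤ d * (u ⬝ᵥ u)) (x : κ → ℝ) :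
    (M *ᵥ x) ⬝ᵥ (M *ᵥ x) ≤ d * (x ⬝ᵥ x) := by
  set y := M *ᵥ x with hy
  have h1 : (y ⬝ᵥ y) ^ 2 ≤ (d * (y ⬝ᵥ y)) * (x ⬝ᵥ x) := by
    have e : y ⬝ᵥ y = (y ᵥ* M) ⬝ᵥ x := by rw [← dotProduct_mulVec]
    calc (y ⬝ᵥ y) ^ 2 = ((y ᵥ* M) ⬝ᵥ x) ^ 2 := by rw [e]
      _ ≤ _ := dotProduct_sq_le _ _
      _ ≤ _ := mul_le_mul_of_nonneg_right (h y) (dotProduct_self_nonneg_real x)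
  rcases (dotProduct_self_nonneg_real y).eq_or_lt with h0 | h0
  · rw [← h0]
    exact mul_nonneg hd (dotProduct_self_nonneg_real x)
  · nlinarith

/-- For a square matrix, a positive lower bound for `‖Mᵀ u‖²` is one for `‖M x‖²`. -/
theorem le_mulVec_dotProduct_self {ι κ : Type*} [Fintype ι] [Fintype κ] [DecidableEq ι]
    [DecidableEq κ]
    (hcard : Fintype.card ι = Fintype.card κ) {M : Matrix ι κ ℝ} {c : ℝ}
    (hc : 0 < c) (h : ∀ u, c * (u ⬝ᵥ u) ≤ (u ᵥ* M) ⬝ᵥ (u ᵥ* M)) (x : κ → ℝ) :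
    c * (x ⬝ᵥ x) ≤ (M *ᵥ x) ⬝ᵥ (M *ᵥ x) := by
  have hinj : Function.Injective M.vecMulLinear := by
    rw [← LinearMap.ker_eq_bot, LinearMap.ker_eq_bot']
    intro u hu
    have hu' : u ᵥ* M = 0 := hu
    have h1 := h u
    rw [hu', dotProduct_zero] at h1
    have h2 : u ⬝ᵥ u = 0 := le_antisymm (by nlinarith) (dotProduct_self_nonneg_real u)
    exact dotProduct_self_eq_zero.1 h2
  have hsurj : Function.Surjective M.vecMulLinear :=
    (LinearMap.injective_iff_surjective_of_finrank_eq_finrank (by simpa using hcard)).1 hinj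
  obtain ⟨u, hu⟩ := hsurj x
  have hu' : u ᵥ* M = x := hu
  have e : x ⬝ᵥ x = u ⬝ᵥ (M *ᵥ x) := by rw [dotProduct_mulVec, hu']
  have h1 := h u
  rw [hu'] at h1
  have h2 := dotProduct_sq_le u (M *ᵥ x)
  rw [← e] at h2
  rcases (dotProduct_self_nonneg_real x).eq_or_lt with h0 | h0
  · rw [← h0, mul_zero]
    exact dotProduct_self_nonneg_real _
  · have h3 := mul_le_mul_of_nonneg_right h1 (dotProduct_self_nonneg_real (M *ᵥ x))
    have h4 := mul_le_mul_of_nonneg_left h2 hc.le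
    nlinarith

theorem sum_subtype_sq {m : ℕ} (S : Finset (Fin m)) (w : Fin m → ℝ) :
    (fun j : S => w j) ⬝ᵥ (fun j : S => w j) = ∑ l ∈ S, w l ^ 2 := by
  rw [← Finset.sum_coe_sort S (fun l => w l ^ 2)]
  simp only [dotProduct, sq]

theorem FrameBound.le_colSubmatrix_mulVec {n m : ℕ} {A : Matrix (Fin n) (Fin m) ℝ} {c : ℝ}
    {S : Finset (Fin m)} (h : FrameBound A c S) (hc : 0 < c) (hS : S.card = n) (x : S → ℝ) :
    c * (x ⬝ᵥ x) ≤ (colSubmatrix A S *ᵥ x) ⬝ᵥ (colSubmatrix A S *ᵥ x) := by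
  refine le_mulVec_dotProduct_self (by simp [hS]) hc (fun u => ?_) x
  exact (h u).trans_eq (sum_subtype_sq S (u ᵥ* A)).symm

theorem FrameBound.linearIndependent {n m : ℕ} {A : Matrix (Fin n) (Fin m) ℝ} {c : ℝ}
    {S : Finset (Fin m)} (h : FrameBound A c S) (hc : 0 < c) (hS : S.card = n) :
    LinearIndependent ℝ (fun j : S => A.col j) := by
  have e : (fun j : S => A.col j) = (colSubmatrix A S).col := rfl
  rw [e, ← Matrix.mulVec_injective_iff]
  intro x y hxy
  have h1 := h.le_colSubmatrix_mulVec hc hS (x - y)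
  have h2 : colSubmatrix A S *ᵥ (x - y) = 0 := by
    rw [mulVec_sub]
    exact sub_eq_zero.2 hxy
  rw [h2, dotProduct_zero] at h1
  have h3 : (x - y) ⬝ᵥ (x - y) = 0 := le_antisymm (by nlinarith) (dotProduct_self_nonneg_real _)
  exact sub_eq_zero.1 (dotProduct_self_eq_zero.1 h3)

theorem FrameBound.span_eq_top {n m : ℕ} {A : Matrix (Fin n) (Fin m) ℝ} {c : ℝ}
    {S : Finset (Fin m)} (h : FrameBound A c S) (hc : 0 < c) (hS : S.card = n) (hn : 1 ≤ n) :
    Submodule.span ℝ (Set.range fun j : S => A.col j) = ⊤ := by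
  have : Nonempty S := (Finset.card_pos.1 (by omega)).to_subtype
  exact (h.linearIndependent hc hS).span_eq_top_of_card_eq_finrank (by simp [hS])

theorem FrameBound.le_sigmaMin_sq {n m : ℕ} {A : Matrix (Fin n) (Fin m) ℝ} {c : ℝ}
    {S : Finset (Fin m)} (h : FrameBound A c S) (hc : 0 < c) (hS : S.card = n) (hn : 1 ≤ n) :
    c ≤ sigmaMin (colSubmatrix A S) ^ 2 := by
  have : Nonempty S := (Finset.card_pos.1 (by omega)).to_subtype
  have : Nonempty (Metric.sphere (0 : EuclideanSpace ℝ S) 1) :=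
    (NormedSpace.sphere_nonempty.2 zero_le_one).to_subtype
  have hcard : Fintype.card S ≤ Fintype.card (Fin n) := by simp [hS]
  have key : √c ≤ sigmaMin (colSubmatrix A S) := by
    rw [sigmaMin, if_pos hcard]
    refine le_ciInf fun x => Real.sqrt_le_iff.2 ⟨norm_nonneg _, ?_⟩
    have hx : ‖(x : EuclideanSpace ℝ S)‖ = 1 := by simp
    have h1 := h.le_colSubmatrix_mulVec hc hS (WithLp.ofLp (x : EuclideanSpace ℝ S))
    have h2 : WithLp.ofLp (x : EuclideanSpace ℝ S) ⬝ᵥ WithLp.ofLp (x : EuclideanSpace ℝ S) = 1 := by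
      have := EuclideanSpace.real_norm_sq_eq (x : EuclideanSpace ℝ S)
      rw [hx] at this
      simp only [dotProduct, ← sq]
      linarith
    rw [h2, mul_one] at h1
    refine h1.trans_eq ?_
    rw [EuclideanSpace.real_norm_sq_eq]
    simp [dotProduct, ← sq, Matrix.toLpLin_apply]
  calc c = √c ^ 2 := (Real.sq_sqrt hc.le).symm
    _ ≤ _ := pow_le_pow_left₀ (Real.sqrt_nonneg _) key 2

/-! ### Orthogonal complements -/

/-- The rows of `A'` are an orthonormal basis of the orthogonal complement of the row space. -/
theorem exists_complement {n m k : ℕ} {A : Matrix (Fin n) (Fin m) ℝ} (hA : A * Aᵀ = 1)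
    (hk : m = n + k) : ∃ A' : Matrix (Fin k) (Fin m) ℝ, A' * A'ᵀ = 1 ∧ A' * Aᵀ = 0 := by
  set L : EuclideanSpace ℝ (Fin m) →ₗ[ℝ] EuclideanSpace ℝ (Fin n) := Matrix.toEuclideanLin A
  have hsurj : Function.Surjective L := by
    intro y
    refine ⟨Matrix.toEuclideanLin Aᵀ y, ?_⟩
    simp [L, Matrix.toLpLin_apply, hA]
  have hdim : Module.finrank ℝ (LinearMap.ker L) = k := by
    have h1 := L.finrank_range_add_finrank_ker
    rw [LinearMap.range_eq_top.2 hsurj, finrank_top, finrank_euclideanSpace_fin,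
      finrank_euclideanSpace_fin] at h1
    omega
  let b := (stdOrthonormalBasis ℝ (LinearMap.ker L)).reindex (finCongr hdim)
  refine ⟨Matrix.of fun i l => (b i : EuclideanSpace ℝ (Fin m)) l, ?_, ?_⟩
  · ext i j
    have h1 := orthonormal_iff_ite.1 b.orthonormal i j
    rw [Submodule.coe_inner, PiLp.inner_apply] at h1
    rw [Matrix.mul_apply, Matrix.one_apply, ← h1]
    exact Finset.sum_congr rfl fun l _ => by simp [mul_comm]
  · ext i j
    have h1 : L (b i) = 0 := (b i).2
    have h2 := congrFun (congrArg WithLp.ofLp h1) j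
    simp only [L, Matrix.toLpLin_apply, mulVec, dotProduct] at h2
    rw [Matrix.mul_apply, Matrix.zero_apply]
    exact (Finset.sum_congr rfl fun l _ => by simp [mul_comm]).trans h2

/-- Passing to the orthogonal complement of the row space and to the complementary set of columns
preserves frame bounds. With `w = Aᵀ u` one has `A'_S w_S = - A'_{Sᶜ} w_{Sᶜ}`, where the left side
has squared norm at least `c ‖w_S‖²` and the right side at most `(1 - c) ‖w_{Sᶜ}‖²`. -/
theorem FrameBound.compl {n m k : ℕ} {A : Matrix (Fin n) (Fin m) ℝ}
    {A' : Matrix (Fin k) (Fin m) ℝ} (hA : A * Aᵀ = 1) (hA' : A' * A'ᵀ = 1) (hAA' : A' * Aᵀ = 0)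
    {c : ℝ} {S : Finset (Fin m)} (h : FrameBound A' c S) (hc : 0 < c) (hc1 : c ≤ 1)
    (hS : S.card = k) : FrameBound A c Sᶜ := by
  intro u
  set w := u ᵥ* A with hw
  have hlow := h.le_colSubmatrix_mulVec hc hS (fun j : S => w j)
  have hup := mulVec_dotProduct_self_le (M := colSubmatrix A' Sᶜ) (d := 1 - c) (by linarith)
    (fun v => ?_) (fun j : (Sᶜ : Finset (Fin m)) => w j)
  · have e : colSubmatrix A' S *ᵥ (fun j : S => w j) =
        - (colSubmatrix A' Sᶜ *ᵥ (fun j : (Sᶜ : Finset (Fin m)) => w j)) := by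
      have h0 : A' *ᵥ w = 0 := by
        rw [hw, ← mulVec_transpose, mulVec_mulVec, hAA', zero_mulVec]
      funext i
      have h1 := congrFun h0 i
      simp only [mulVec, dotProduct, Pi.zero_apply] at h1
      rw [← Finset.sum_add_sum_compl S, ← Finset.sum_coe_sort S, ← Finset.sum_coe_sort Sᶜ] at h1
      exact eq_neg_of_add_eq_zero_left h1
    rw [e, neg_dotProduct_neg] at hlow
    rw [sum_subtype_sq] at hlow hup
    have hsum : u ⬝ᵥ u = ∑ l ∈ S, w l ^ 2 + ∑ l ∈ Sᶜ, w l ^ 2 := by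
      rw [← vecMul_dotProduct_self_of_mul_transpose_eq_one hA u, Finset.sum_add_sum_compl]
      simp only [dotProduct, sq, hw]
    rw [hsum]
    linarith
  · have h1 := h v
    have h2 := sum_subtype_sq Sᶜ (v ᵥ* A')
    have h3 := vecMul_dotProduct_self_of_mul_transpose_eq_one hA' v
    have h4 : (v ᵥ* A') ⬝ᵥ (v ᵥ* A') =
        ∑ l ∈ S, (v ᵥ* A') l ^ 2 + ∑ l ∈ Sᶜ, (v ᵥ* A') l ^ 2 := by
      rw [Finset.sum_add_sum_compl]
      simp only [dotProduct, sq]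
    change (fun j : (Sᶜ : Finset (Fin m)) => (v ᵥ* A') j) ⬝ᵥ
      (fun j : (Sᶜ : Finset (Fin m)) => (v ᵥ* A') j) ≤ _
    rw [h2]
    linarith

/-! ### Column sets of maximal volume -/

theorem exists_det_submatrix_ne_zero {n m : ℕ} {A : Matrix (Fin n) (Fin m) ℝ} (hA : A * Aᵀ = 1) :
    ∃ f : Fin n → Fin m, (A.submatrix id f).det ≠ 0 := by
  by_contra! h
  have hrow : A * Aᵀ = fun i => ∑ l, A i l • Aᵀ l := by
    funext i j
    simp [Matrix.mul_apply]
  have h1 : (A * Aᵀ).det = 0 := by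
    rw [hrow]
    change (detRowAlternating : (Fin n → ℝ) [⋀^Fin n]→ₗ[ℝ] ℝ).toMultilinearMap
      (fun i => ∑ l, A i l • Aᵀ l) = 0
    rw [MultilinearMap.map_sum]
    refine Finset.sum_eq_zero fun r _ => ?_
    rw [MultilinearMap.map_smul_univ]
    have h2 : (detRowAlternating : (Fin n → ℝ) [⋀^Fin n]→ₗ[ℝ] ℝ).toMultilinearMap
        (fun i => Aᵀ (r i)) = (A.submatrix id r)ᵀ.det := rfl
    rw [h2, det_transpose, h r, smul_zero]
  rw [hA, det_one] at h1
  exact one_ne_zero h1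

/-- `n` columns of maximal volume: every column of `A` is a combination of them with coefficients
in `[-1, 1]`, because by Cramer's rule these coefficients are quotients of volumes. -/
theorem exists_maxVolume {n m : ℕ} {A : Matrix (Fin n) (Fin m) ℝ} (hA : A * Aᵀ = 1) :
    ∃ (f : Fin n → Fin m) (C : Matrix (Fin n) (Fin m) ℝ), Function.Injective f ∧
      (∀ k i, C k (f i) = if k = i then 1 else 0) ∧ (∀ k l, C k l ^ 2 ≤ 1) ∧
      ∀ (u : Fin n → ℝ) l, (u ᵥ* A) l = ∑ k, C k l * (u ᵥ* A) (f k) := by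
  obtain ⟨f₀, hf₀⟩ := exists_det_submatrix_ne_zero hA
  obtain ⟨f, -, hf⟩ := Finset.exists_max_image Finset.univ
    (fun f : Fin n → Fin m => |(A.submatrix id f).det|) ⟨f₀, Finset.mem_univ _⟩
  set N := A.submatrix id f with hN
  have hdet : N.det ≠ 0 := by
    have h1 := hf f₀ (Finset.mem_univ _)
    exact abs_pos.1 ((abs_pos.2 hf₀).trans_le h1)
  have hunit : IsUnit N.det := hdet.isUnit
  have hNN : N⁻¹ * N = 1 := nonsing_inv_mul _ hunit
  have hdelta : ∀ k i, (N⁻¹ * A) k (f i) = if k = i then 1 else 0 := by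
    intro k i
    rw [← Matrix.one_apply, ← hNN]
    rfl
  refine ⟨f, N⁻¹ * A, fun i j hij => ?_, hdelta, fun k l => ?_, fun u l => ?_⟩
  · by_contra hne
    have h1 := hdelta i i
    rw [hij, hdelta i j, if_neg hne, if_pos rfl] at h1
    exact zero_ne_one h1
  · have h1 : N.det * (N⁻¹ * A) k l = (N.updateCol k (A.col l)).det := by
      rw [← cramer_apply, ← det_smul_inv_mulVec_eq_cramer _ _ hunit]
      rfl
    have h2 : N.updateCol k (A.col l) = A.submatrix id (Function.update f k l) := by
      ext a b
      by_cases hb : b = k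
      · subst hb
        simp
      · simp [hb, hN]
    have h3 := hf (Function.update f k l) (Finset.mem_univ _)
    rw [← h2, ← h1, abs_mul] at h3
    have h4 : |(N⁻¹ * A) k l| ≤ 1 := by
      by_contra! h5
      nlinarith [abs_pos.2 hdet]
    rw [sq_le_one_iff_abs_le_one]
    exact h4
  · have h1 : A = N * (N⁻¹ * A) := by
      rw [← Matrix.mul_assoc, mul_nonsing_inv _ hunit, Matrix.one_mul]
    have h2 : u ᵥ* A = (u ᵥ* N) ᵥ* (N⁻¹ * A) := by rw [vecMul_vecMul, ← h1]
    rw [congrFun h2 l]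
    change ∑ k, (u ᵥ* N) k * (N⁻¹ * A) k l = _
    exact Finset.sum_congr rfl fun k _ => mul_comm _ _

/-- If the columns outside the image of `g` are combinations of those inside, with coefficients `D`
such that `‖Dᵀ w‖² ≤ T ‖w‖²`, then the columns inside have lower frame bound `1 / (1 + T)`. -/
theorem frameBound_of_coeff {n m : ℕ} {A : Matrix (Fin n) (Fin m) ℝ} (hA : A * Aᵀ = 1)
    {g : Fin n → Fin m} (hg : Function.Injective g) {D : Fin n → Fin m → ℝ} {T : ℝ} (hT : 0 ≤ T)
    (hD : ∀ (u : Fin n → ℝ) l, (u ᵥ* A) l = ∑ k, D k l * (u ᵥ* A) (g k))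
    (hDT : ∀ w : Fin n → ℝ,
      ∑ l ∈ (univ.image g)ᶜ, (∑ k, D k l * w k) ^ 2 ≤ T * ∑ k, w k ^ 2) :
    FrameBound A (1 / (1 + T)) (univ.image g) := by
  intro u
  have h1 := hDT (fun k => (u ᵥ* A) (g k))
  rw [Finset.sum_congr rfl fun l _ => congrArg (· ^ 2) (hD u l).symm] at h1
  have h2 : ∑ l ∈ univ.image g, (u ᵥ* A) l ^ 2 = ∑ k, (u ᵥ* A) (g k) ^ 2 :=
    Finset.sum_image fun a _ b _ hab => hg hab
  have h3 : u ⬝ᵥ u = ∑ l ∈ univ.image g, (u ᵥ* A) l ^ 2 +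
      ∑ l ∈ (univ.image g)ᶜ, (u ᵥ* A) l ^ 2 := by
    rw [← vecMul_dotProduct_self_of_mul_transpose_eq_one hA u, Finset.sum_add_sum_compl]
    simp only [dotProduct, sq]
  rw [div_mul_eq_mul_div, one_mul, div_le_iff₀ (by linarith), h3, h2]
  linarith

theorem frameBound_of_sum_sq_le {n m : ℕ} {A : Matrix (Fin n) (Fin m) ℝ} (hA : A * Aᵀ = 1)
    {g : Fin n → Fin m} (hg : Function.Injective g) {D : Fin n → Fin m → ℝ} {T : ℝ} (hT : 0 ≤ T)
    (hD : ∀ (u : Fin n → ℝ) l, (u ᵥ* A) l = ∑ k, D k l * (u ᵥ* A) (g k))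
    (hDT : ∑ l ∈ (univ.image g)ᶜ, ∑ k, D k l ^ 2 ≤ T) :
    FrameBound A (1 / (1 + T)) (univ.image g) := by
  refine frameBound_of_coeff hA hg hT hD fun w => ?_
  calc ∑ l ∈ (univ.image g)ᶜ, (∑ k, D k l * w k) ^ 2
      ≤ ∑ l ∈ (univ.image g)ᶜ, (∑ k, D k l ^ 2) * ∑ k, w k ^ 2 :=
        Finset.sum_le_sum fun l _ => Finset.sum_mul_sq_le_sq_mul_sq _ _ _
    _ = (∑ l ∈ (univ.image g)ᶜ, ∑ k, D k l ^ 2) * ∑ k, w k ^ 2 := by rw [Finset.sum_mul]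
    _ ≤ _ := mul_le_mul_of_nonneg_right hDT (Finset.sum_nonneg fun _ _ => sq_nonneg _)

/-- The spectral norm of the Gram matrix of the coefficients is at most its Frobenius norm. -/
theorem frameBound_of_gram_le {n m : ℕ} {A : Matrix (Fin n) (Fin m) ℝ} (hA : A * Aᵀ = 1)
    {g : Fin n → Fin m} (hg : Function.Injective g) {D : Fin n → Fin m → ℝ} {T : ℝ} (hT : 0 ≤ T)
    (hD : ∀ (u : Fin n → ℝ) l, (u ᵥ* A) l = ∑ k, D k l * (u ᵥ* A) (g k))
    (hDT : ∑ i, ∑ k, (∑ l ∈ (univ.image g)ᶜ, D i l * D k l) ^ 2 ≤ T ^ 2) :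
    FrameBound A (1 / (1 + T)) (univ.image g) := by
  refine frameBound_of_coeff hA hg hT hD fun w => ?_
  set J := (univ.image g)ᶜ
  have h1 : ∑ l ∈ J, (∑ k, D k l * w k) ^ 2 =
      ∑ p : Fin n × Fin n, (∑ l ∈ J, D p.1 l * D p.2 l) * (w p.1 * w p.2) := by
    rw [Fintype.sum_prod_type]
    simp only [sq, Finset.sum_mul_sum]
    rw [Finset.sum_comm]
    refine Finset.sum_congr rfl fun i _ => ?_
    rw [Finset.sum_comm]
    refine Finset.sum_congr rfl fun k _ => ?_
    rw [Finset.sum_mul]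
    exact Finset.sum_congr rfl fun l _ => by ring
  have h2 : ∑ p : Fin n × Fin n, (w p.1 * w p.2) ^ 2 = (∑ k, w k ^ 2) ^ 2 := by
    rw [Fintype.sum_prod_type, sq (∑ k, w k ^ 2), Finset.sum_mul_sum]
    simp only [mul_pow]
  have h3 : 0 ≤ ∑ k, w k ^ 2 := Finset.sum_nonneg fun _ _ => sq_nonneg _
  refine abs_le_of_sq_le_sq' (a := ∑ l ∈ J, (∑ k, D k l * w k) ^ 2) ?_ (mul_nonneg hT h3) |>.2
  rw [h1]
  refine (Finset.sum_mul_sq_le_sq_mul_sq _ _ _).trans ?_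
  rw [h2, mul_pow, Fintype.sum_prod_type]
  exact mul_le_mul_of_nonneg_right hDT (sq_nonneg _)

/-! ### Exchanging one column -/

theorem injective_update_of_notMem {α β : Type*} [DecidableEq α] {f : α → β}
    (hf : Function.Injective f) (i : α) {j : β} (hj : ∀ k, f k ≠ j) :
    Function.Injective (Function.update f i j) := by
  intro a b hab
  by_cases ha : a = i <;> by_cases hb : b = i
  · rw [ha, hb]
  · subst ha
    rw [Function.update_self, Function.update_of_ne hb] at hab
    exact absurd hab.symm (hj b)
  · subst hb
    rw [Function.update_self, Function.update_of_ne ha] at hab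
    exact absurd hab (hj a)
  · rw [Function.update_of_ne ha, Function.update_of_ne hb] at hab
    exact hf hab

/-- Exchanging the column `f i` for the column `j` outside the image of `f`. The new coefficients
are `C i l / C i j` in row `i` and `C k l - C i l * C k j / C i j` in the other rows; the hypothesis
bounds the sum of their squares over the new outside columns by `T`. -/
theorem frameBound_update {n m : ℕ} {A : Matrix (Fin n) (Fin m) ℝ} (hA : A * Aᵀ = 1)
    {f : Fin n → Fin m} (hf : Function.Injective f) {C : Matrix (Fin n) (Fin m) ℝ} {T : ℝ}
    (hT : 0 ≤ T) (hdelta : ∀ k i, C k (f i) = if k = i then 1 else 0)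
    (hC : ∀ (u : Fin n → ℝ) l, (u ᵥ* A) l = ∑ k, C k l * (u ᵥ* A) (f k))
    {i : Fin n} {j : Fin m} (hj : j ∈ (univ.image f)ᶜ) (hij : C i j ≠ 0)
    (hcost : 1 + (∑ k, C k j ^ 2 - C i j ^ 2) + (∑ l ∈ (univ.image f)ᶜ, C i l ^ 2 - C i j ^ 2) +
      ∑ l ∈ (univ.image f)ᶜ, ∑ k, (C k l * C i j - C i l * C k j) ^ 2 ≤ T * C i j ^ 2) :
    FrameBound A (1 / (1 + T)) (univ.image (Function.update f i j)) := by
  have hinj := injective_update_of_notMem hf i (by simpa using hj)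
  refine frameBound_of_sum_sq_le (D := fun k l => if k = i then C i l / C i j
    else C k l - C i l * C k j / C i j) hA hinj hT (fun u l => ?_) ?_
  · have e : ∀ k, (if k = i then C i l / C i j else C k l - C i l * C k j / C i j) *
        (u ᵥ* A) (Function.update f i j k) = (if k = i then C i l / C i j * (u ᵥ* A) j else 0) +
        (C k l * (u ᵥ* A) (f k) - C i l / C i j * (C k j * (u ᵥ* A) (f k))) := by
      intro k
      by_cases hk : k = i
      · subst hk
        simp only [if_true, Function.update_self]
        field_simp
        ring
      · simp only [if_neg hk, Function.update_of_ne hk]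
        ring
    rw [Finset.sum_congr rfl fun k _ => e k, Finset.sum_add_distrib, Finset.sum_sub_distrib,
      ← Finset.mul_sum, ← hC, ← hC, Finset.sum_ite_eq' univ i, if_pos (Finset.mem_univ i)]
    ring
  · set F : Fin m → ℝ := fun l => ∑ k, (if k = i then C i l / C i j
      else C k l - C i l * C k j / C i j) ^ 2 with hF
    have hF0 : ∀ l, 0 ≤ F l := fun l => Finset.sum_nonneg fun _ _ => sq_nonneg _
    have hFl : ∀ l, F l * C i j ^ 2 = C i l ^ 2 + ∑ k, (C k l * C i j - C i l * C k j) ^ 2 := by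
      intro l
      have e : ∀ k, (if k = i then C i l / C i j else C k l - C i l * C k j / C i j) ^ 2 *
          C i j ^ 2 = (if k = i then C i l ^ 2 else 0) + (C k l * C i j - C i l * C k j) ^ 2 := by
        intro k
        by_cases hk : k = i
        · subst hk
          simp only [if_true]
          field_simp
          ring
        · simp only [if_neg hk]
          field_simp
          ring
      rw [hF]
      simp only [Finset.sum_mul]
      rw [Finset.sum_congr rfl fun k _ => e k, Finset.sum_add_distrib, Finset.sum_ite_eq' univ i,
        if_pos (Finset.mem_univ i)]
    have hFfi : F (f i) * C i j ^ 2 = 1 + (∑ k, C k j ^ 2 - C i j ^ 2) := by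
      have e : ∀ k, (C k (f i) * C i j - C i (f i) * C k j) ^ 2 =
          C k j ^ 2 - (if k = i then C i j ^ 2 else 0) := by
        intro k
        by_cases hk : k = i
        · subst hk
          simp
        · simp [hdelta, hk]
      rw [hFl, Finset.sum_congr rfl fun k _ => e k, Finset.sum_sub_distrib,
        Finset.sum_ite_eq' univ i, if_pos (Finset.mem_univ i), hdelta, if_pos rfl]
      ring
    have hFj : F j * C i j ^ 2 = C i j ^ 2 := by
      rw [hFl, add_eq_left]
      exact Finset.sum_eq_zero fun k _ => by ring
    have hsub : (univ.image (Function.update f i j))ᶜ ⊆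
        insert (f i) ((univ.image f)ᶜ.erase j) := by
      intro l hl
      simp only [mem_compl, mem_image, mem_univ, true_and, not_exists] at hl
      rw [mem_insert, mem_erase]
      by_cases hli : l = f i
      · exact Or.inl hli
      · refine Or.inr ⟨fun h => hl i (by rw [Function.update_self, h]), ?_⟩
        simp only [mem_compl, mem_image, mem_univ, true_and, not_exists]
        intro k hk
        by_cases hki : k = i
        · exact hli (by rw [← hk, hki])
        · exact hl k (by rw [Function.update_of_ne hki, hk])
    have hle : ∑ l ∈ (univ.image (Function.update f i j))ᶜ, F l ≤
        F (f i) + (∑ l ∈ (univ.image f)ᶜ, F l - F j) := by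
      refine (Finset.sum_le_sum_of_subset_of_nonneg hsub fun l _ _ => hF0 l).trans_eq ?_
      rw [Finset.sum_insert (by simp), ← Finset.add_sum_erase _ _ hj]
      ring
    have hpos : 0 < C i j ^ 2 := by positivity
    have hsum : (∑ l ∈ (univ.image f)ᶜ, F l) * C i j ^ 2 = ∑ l ∈ (univ.image f)ᶜ, C i l ^ 2 +
        ∑ l ∈ (univ.image f)ᶜ, ∑ k, (C k l * C i j - C i l * C k j) ^ 2 := by
      rw [Finset.sum_mul, Finset.sum_congr rfl fun l _ => hFl l, Finset.sum_add_distrib]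
    refine le_of_mul_le_mul_right ?_ hpos
    refine (mul_le_mul_of_nonneg_right hle hpos.le).trans (le_trans (le_of_eq ?_) hcost)
    rw [add_mul, sub_mul, hFfi, hFj, hsum]
    ring

/-- Lagrange's identity for the `2 × 2` minors of a matrix. -/
theorem sum_minors_sq {ι κ : Type*} [Fintype ι] (J : Finset κ) (C : ι → κ → ℝ) :
    ∑ i, ∑ j ∈ J, ∑ l ∈ J, ∑ k, (C k l * C i j - C i l * C k j) ^ 2 =
      2 * ((∑ i, ∑ j ∈ J, C i j ^ 2) ^ 2 - ∑ i, ∑ k, (∑ l ∈ J, C i l * C k l) ^ 2) := by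
  have hsq : (∑ i, ∑ j ∈ J, C i j ^ 2) ^ 2 =
      ∑ i, ∑ k, ∑ j ∈ J, ∑ l ∈ J, C i j ^ 2 * C k l ^ 2 := by
    rw [sq, Finset.sum_mul_sum]
    simp only [Finset.sum_mul_sum]
  have hgram : ∑ i, ∑ k, (∑ l ∈ J, C i l * C k l) ^ 2 =
      ∑ i, ∑ k, ∑ j ∈ J, ∑ l ∈ J, C i j * C k j * (C i l * C k l) := by
    simp only [sq, Finset.sum_mul_sum]
  have hflip : ∑ i, ∑ k, ∑ j ∈ J, ∑ l ∈ J, C i l ^ 2 * C k j ^ 2 =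
      ∑ i, ∑ k, ∑ j ∈ J, ∑ l ∈ J, C i j ^ 2 * C k l ^ 2 :=
    Finset.sum_congr rfl fun i _ => Finset.sum_congr rfl fun k _ => Finset.sum_comm
  have hleft : ∑ i, ∑ j ∈ J, ∑ l ∈ J, ∑ k, (C k l * C i j - C i l * C k j) ^ 2 =
      ∑ i, ∑ k, ∑ j ∈ J, ∑ l ∈ J, (C i j ^ 2 * C k l ^ 2 + C i l ^ 2 * C k j ^ 2 -
        C i j * C k j * (C i l * C k l) - C i j * C k j * (C i l * C k l)) := by
    refine Finset.sum_congr rfl fun i _ => ?_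
    rw [(Finset.sum_congr rfl fun j _ => Finset.sum_comm).trans Finset.sum_comm]
    refine Finset.sum_congr rfl fun k _ => Finset.sum_congr rfl fun j _ =>
      Finset.sum_congr rfl fun l _ => ?_
    ring
  rw [hleft, hsq, hgram]
  simp only [Finset.sum_sub_distrib, Finset.sum_add_distrib]
  rw [hflip]
  ring

/-- Either `n` columns of maximal volume, or columns obtained from them by one exchange, have lower
frame bound `1 / (1 + T)`. Here `e` in the hypothesis stands for the sum of the squares of the
coefficients of the other columns, and the left side for the sum over all exchanges `(i, j)` of
`C i j ²` times the corresponding sum after the exchange. -/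
theorem exists_frameBound_of_exchange {n m : ℕ} {A : Matrix (Fin n) (Fin m) ℝ} (hA : A * Aᵀ = 1)
    {N K T : ℝ} (hN : (n : ℝ) = N) (hK : (m : ℝ) - n = K) (hT : 0 ≤ T)
    (h : ∀ e, T ≤ e → e ≤ N * K → N * K + (N + K - 2) * e + 2 * (e ^ 2 - T ^ 2) ≤ T * e) :
    ∃ S : Finset (Fin m), S.card = n ∧ FrameBound A (1 / (1 + T)) S := by
  obtain ⟨f, C, hf, hdelta, hC1, hC⟩ := exists_maxVolume hA
  set J := (univ.image f)ᶜ with hJ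
  have hcard : (univ.image f).card = n := by
    rw [Finset.card_image_of_injective _ hf, Finset.card_univ, Fintype.card_fin]
  have hJcard : (J.card : ℝ) = K := by
    have h1 := Finset.card_add_card_compl (univ.image f)
    rw [hcard, Fintype.card_fin] at h1
    have h2 : (n : ℝ) + J.card = m := by exact_mod_cast h1
    linarith
  by_cases hG : ∑ i, ∑ k, (∑ l ∈ J, C i l * C k l) ^ 2 ≤ T ^ 2
  · exact ⟨_, hcard, frameBound_of_gram_le hA hf hT hC hG⟩
  by_contra! hno
  set e := ∑ i, ∑ j ∈ J, C i j ^ 2 with he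
  have hpiv : ∀ i, ∀ j ∈ J, T * C i j ^ 2 ≤ 1 + (∑ k, C k j ^ 2 - C i j ^ 2) +
      (∑ l ∈ J, C i l ^ 2 - C i j ^ 2) + ∑ l ∈ J, ∑ k, (C k l * C i j - C i l * C k j) ^ 2 := by
    intro i j hj
    have hrow : C i j ^ 2 ≤ ∑ l ∈ J, C i l ^ 2 :=
      Finset.single_le_sum (f := fun l => C i l ^ 2) (fun _ _ => sq_nonneg _) hj
    have hcol : C i j ^ 2 ≤ ∑ k, C k j ^ 2 :=
      Finset.single_le_sum (f := fun k => C k j ^ 2) (fun _ _ => sq_nonneg _) (Finset.mem_univ i)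
    have hmin : 0 ≤ ∑ l ∈ J, ∑ k, (C k l * C i j - C i l * C k j) ^ 2 :=
      Finset.sum_nonneg fun _ _ => Finset.sum_nonneg fun _ _ => sq_nonneg _
    -- the entries `C i j = 0` allow no exchange, but have weight zero
    by_cases hij : C i j = 0
    · rw [hij] at hrow hcol hmin ⊢
      linarith
    · by_contra! hlt
      have hjf : ∀ k, f k ≠ j := fun k hk => by simp [hJ, ← hk] at hj
      refine hno _ ?_ (frameBound_update hA hf hT hdelta hC hj hij hlt.le)
      rw [Finset.card_image_of_injective, Finset.card_univ, Fintype.card_fin]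
      exact injective_update_of_notMem hf i hjf
  have hsum := Finset.sum_le_sum fun i (_ : i ∈ univ) => Finset.sum_le_sum (hpiv i)
  have hcols : ∑ j ∈ J, ∑ k, C k j ^ 2 = e := Finset.sum_comm
  simp only [Finset.sum_add_distrib, Finset.sum_sub_distrib, ← Finset.mul_sum, Finset.sum_const,
    nsmul_eq_mul, Finset.card_univ, Fintype.card_fin, hJcard, hN, ← he, hcols, mul_one] at hsum
  have hlag := sum_minors_sq J C
  have hmin : 0 ≤ ∑ i, ∑ j ∈ J, ∑ l ∈ J, ∑ k, (C k l * C i j - C i l * C k j) ^ 2 :=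
    Finset.sum_nonneg fun _ _ => Finset.sum_nonneg fun _ _ => Finset.sum_nonneg fun _ _ =>
      Finset.sum_nonneg fun _ _ => sq_nonneg _
  have he0 : 0 ≤ e := Finset.sum_nonneg fun _ _ => Finset.sum_nonneg fun _ _ => sq_nonneg _
  -- the sum of the squared minors is non-negative, so `e² ≥ ‖B Bᵀ‖_F² > T²`
  have heT : T ≤ e := by
    exact (le_abs_self T).trans (abs_le_of_sq_le_sq (by linarith) he0)
  have heNK : e ≤ N * K := by
    calc e ≤ ∑ i : Fin n, ∑ j ∈ J, (1 : ℝ) :=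
          Finset.sum_le_sum fun i _ => Finset.sum_le_sum fun j _ => hC1 i j
      _ = N * K := by simp [hJcard, hN]
  linarith [h e heT heNK]

/-! ### Two rows -/

/-- The hypothesis `hroot` says that `det (a_i a_iᵀ + a_j a_jᵀ - c)`, summed over `j ≠ i`, is
non-negative already when the longest column has its least possible squared length `2 / m`. -/
theorem exists_frameBound_pair {m : ℕ} {A : Matrix (Fin 2) (Fin m) ℝ} (hA : A * Aᵀ = 1)
    (hm : 3 ≤ m) {c : ℝ} (hc : 0 < c) (hcm : c * m ≤ 1)
    (hroot : 0 ≤ 2 - 4 * (m - 1) * c + m * (m - 1) * c ^ 2) :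
    ∃ S : Finset (Fin m), S.card = 2 ∧ FrameBound A c S := by
  have hm' : (3 : ℝ) ≤ m := by exact_mod_cast hm
  have hpp : ∑ l, A 0 l ^ 2 = 1 := by
    have h1 := congrFun (congrFun hA 0) 0
    simpa [Matrix.mul_apply, ← sq] using h1
  have hqq : ∑ l, A 1 l ^ 2 = 1 := by
    have h1 := congrFun (congrFun hA 1) 1
    simpa [Matrix.mul_apply, ← sq] using h1
  have hpq : ∑ l, A 0 l * A 1 l = 0 := by
    have h1 := congrFun (congrFun hA 0) 1
    simpa [Matrix.mul_apply] using h1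
  obtain ⟨i, -, hi⟩ := Finset.exists_max_image (univ : Finset (Fin m))
    (fun l => A 0 l ^ 2 + A 1 l ^ 2) ⟨⟨0, by omega⟩, Finset.mem_univ _⟩
  set L := A 0 i ^ 2 + A 1 i ^ 2 with hL
  have hLm : 2 ≤ m * L := by
    have h1 := Finset.sum_le_sum hi
    rw [Finset.sum_add_distrib, hpp, hqq] at h1
    simp only [Finset.sum_const, nsmul_eq_mul, Finset.card_univ, Fintype.card_fin] at h1
    linarith
  -- the determinant of the Gram matrix of the columns `i`, `j`, minus `c` times the identity
  set F : Fin m → ℝ := fun j => (A 0 i * A 1 j - A 1 i * A 0 j) ^ 2 -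
    c * (L + (A 0 j ^ 2 + A 1 j ^ 2)) + c ^ 2 with hF
  have hsum : ∑ j, F j = L - c * (m * L + 2) + m * c ^ 2 := by
    have e : ∀ j, F j = A 0 i ^ 2 * A 1 j ^ 2 + A 1 i ^ 2 * A 0 j ^ 2 -
        2 * (A 0 i * A 1 i) * (A 0 j * A 1 j) -
        (c * L + c * A 0 j ^ 2 + c * A 1 j ^ 2) + c ^ 2 := fun j => by
      rw [hF]
      ring
    rw [Finset.sum_congr rfl fun j _ => e j]
    simp only [Finset.sum_add_distrib, Finset.sum_sub_distrib, ← Finset.mul_sum, hpp, hqq, hpq,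
      Finset.sum_const, nsmul_eq_mul, Finset.card_univ, Fintype.card_fin]
    rw [hL]
    ring
  have hsum' : ∑ j ∈ univ.erase i, F j = L * (1 - (m - 2) * c) - 2 * c + (m - 1) * c ^ 2 := by
    have h1 := Finset.add_sum_erase univ F (Finset.mem_univ i)
    have h2 : F i = -2 * c * L + c ^ 2 := by
      rw [hF]
      ring
    rw [hsum, h2] at h1
    linarith
  have hnonneg : ∑ j ∈ univ.erase i, (0 : ℝ) ≤ ∑ j ∈ univ.erase i, F j := by
    rw [Finset.sum_const_zero, hsum']
    have h1 : 0 ≤ 1 - (m - 2) * c := by nlinarith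
    have h2 := mul_le_mul_of_nonneg_right hLm h1
    have h3 : 0 ≤ m * (L * (1 - (m - 2) * c) - 2 * c + (m - 1) * c ^ 2) := by linarith
    exact nonneg_of_mul_nonneg_right h3 (by linarith)
  have hne : (univ.erase i).Nonempty := by
    rw [← Finset.card_pos, Finset.card_erase_of_mem (Finset.mem_univ i), Finset.card_univ,
      Fintype.card_fin]
    omega
  obtain ⟨j, hj, hFj⟩ := Finset.exists_le_of_sum_le hne hnonneg
  have hji : i ≠ j := (Finset.ne_of_mem_erase hj).symm
  refine ⟨{i, j}, Finset.card_pair hji, fun u => ?_⟩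
  rw [Finset.sum_pair hji]
  simp only [vecMul, dotProduct, Fin.sum_univ_two]
  -- the Gram matrix minus `c` has non-negative determinant and trace, hence is positive semidefinite
  set P := A 0 i ^ 2 + A 0 j ^ 2 - c with hP
  set Q := A 1 i ^ 2 + A 1 j ^ 2 - c with hQ
  set O := A 0 i * A 1 i + A 0 j * A 1 j with hO
  have hdet : O ^ 2 ≤ P * Q := by
    have h1 : P * Q - O ^ 2 = F j := by
      rw [hP, hQ, hO, hF, hL]
      ring
    linarith
  have htr : 0 ≤ P + Q := by
    have h1 : 2 * c ≤ L := by
      have h2 : m * (2 * c) ≤ m * L := by linarith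
      exact le_of_mul_le_mul_left h2 (by linarith)
    have h2 : P + Q = L - 2 * c + (A 0 j ^ 2 + A 1 j ^ 2) := by
      rw [hP, hQ, hL]
      ring
    rw [h2]
    nlinarith [sq_nonneg (A 0 j), sq_nonneg (A 1 j)]
  have hpsd : 0 ≤ P * u 0 ^ 2 + 2 * O * (u 0 * u 1) + Q * u 1 ^ 2 := by
    rcases htr.eq_or_lt with h0 | h0
    · have hQP : Q = -P := by linarith
      have hP0 : P = 0 := by
        rw [hQP] at hdet
        nlinarith [sq_nonneg O]
      have hO0 : O = 0 := by
        rw [hP0] at hdet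
        nlinarith
      rw [hQP, hP0, hO0]
      simp
    · have h1 : 0 ≤ (P + Q) * (P * u 0 ^ 2 + 2 * O * (u 0 * u 1) + Q * u 1 ^ 2) := by
        have h2 : (P + Q) * (P * u 0 ^ 2 + 2 * O * (u 0 * u 1) + Q * u 1 ^ 2) =
            (P * u 0 + O * u 1) ^ 2 + (O * u 0 + Q * u 1) ^ 2 +
            (P * Q - O ^ 2) * (u 0 ^ 2 + u 1 ^ 2) := by ring
        rw [h2]
        have := sub_nonneg.2 hdet
        positivity
      exact nonneg_of_mul_nonneg_right h1 h0
  have h3 : (u 0 * A 0 i + u 1 * A 1 i) ^ 2 + (u 0 * A 0 j + u 1 * A 1 j) ^ 2 -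
      c * (u 0 * u 0 + u 1 * u 1) = P * u 0 ^ 2 + 2 * O * (u 0 * u 1) + Q * u 1 ^ 2 := by
    rw [hP, hQ, hO]
    ring
  linarith

/-! ### The constant `α` -/

/-- With `r = min n k` and `s = max n k`, the two cases of the definition of `α` are one:
`α` is the larger root of `α (1 - α) = (r - 1) (s - r + 1) / (r³ s)`. -/
theorem alpha_spec {n k : ℕ} (hn : 1 ≤ n) (hk : 1 ≤ k) :
    1 / 2 ≤ alpha (n + k) n ∧ alpha (n + k) n ≤ 1 ∧
      alpha (n + k) n * (1 - alpha (n + k) n) * ((min n k : ℕ) ^ 3 * (max n k : ℕ)) =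
        ((min n k : ℕ) - 1) * ((max n k : ℕ) - (min n k : ℕ) + 1) := by
  have hn' : (1 : ℝ) ≤ n := by exact_mod_cast hn
  have hk' : (1 : ℝ) ≤ k := by exact_mod_cast hk
  have key : ∀ {r s : ℝ}, 1 ≤ r → r ≤ s → ∀ {h a : ℝ},
      h * (r ^ 3 * s) = 4 * ((r - 1) * (s - r + 1)) →
      a = 1 / 2 + 1 / 2 * √(1 - h) → 1 / 2 ≤ a ∧ a ≤ 1 ∧
        a * (1 - a) * (r ^ 3 * s) = (r - 1) * (s - r + 1) := by
    intro r s hr hrs h a hh ha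
    have hr0 : 0 < r := by linarith
    have hs0 : 0 < s := by linarith
    have hpos : 0 < r ^ 3 * s := by positivity
    have h0 : 0 ≤ h := by
      have h1 : 0 ≤ h * (r ^ 3 * s) := by
        rw [hh]
        have := mul_nonneg (sub_nonneg.2 hr) (by linarith : 0 ≤ s - r + 1)
        linarith
      exact nonneg_of_mul_nonneg_left h1 hpos
    have h1 : h ≤ 1 := by
      refine le_of_mul_le_mul_right ?_ hpos
      have h2 : (r - 1) * (s - r + 1) ≤ (r - 1) * s :=
        mul_le_mul_of_nonneg_left (by linarith) (by linarith)
      have h3 : 4 * (r - 1) ≤ r ^ 3 := by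
        nlinarith [mul_nonneg (by linarith : 0 ≤ r) (sq_nonneg (r - 2))]
      have h4 := mul_le_mul_of_nonneg_right h3 (by linarith : 0 ≤ s)
      linarith
    have hs := Real.sqrt_nonneg (1 - h)
    have hs2 := Real.sq_sqrt (sub_nonneg.2 h1)
    have hs1 : √(1 - h) ≤ 1 := Real.sqrt_le_one.2 (by linarith)
    refine ⟨by linarith, by linarith, ?_⟩
    have h5 : a * (1 - a) = h / 4 := by
      rw [ha]
      linarith
    rw [h5]
    linarith
  rcases le_total n k with h | h
  · rw [min_eq_left h, max_eq_right h]
    refine key hn' (by exact_mod_cast h) (h := h₁ ((n + k : ℕ) : ℝ) n n) ?_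
      (alpha_of_ge (by omega))
    rw [h₁]
    push_cast
    rw [show (n : ℝ) + k - n = k by ring]
    field_simp
    ring
  · rw [min_eq_right h, max_eq_left h]
    refine key hk' (by exact_mod_cast h) (h := h₂ ((n + k : ℕ) : ℝ) n n) ?_
      (alpha_of_le hn (by omega))
    rw [h₂]
    push_cast
    rw [show (n : ℝ) + k - n = k by ring]
    field_simp
    ring

theorem alpha_lt_one {n k : ℕ} (hn : 2 ≤ n) (hk : 2 ≤ k) : alpha (n + k) n < 1 := by
  obtain ⟨-, h1, h2⟩ := alpha_spec (by omega : 1 ≤ n) (by omega : 1 ≤ k)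
  refine lt_of_le_of_ne h1 fun h => ?_
  rw [h] at h2
  have hr : (2 : ℝ) ≤ (min n k : ℕ) := by exact_mod_cast le_min hn hk
  have hrs : ((min n k : ℕ) : ℝ) ≤ (max n k : ℕ) := by exact_mod_cast min_le_max
  nlinarith

/-! ### Selecting the columns -/

/-- The inequality that makes one exchange succeed on average. As a function of `e` the difference
of the two sides is convex, so only the ends of the interval matter. -/
theorem exchange_inequality {n k : ℕ} (hn : 3 ≤ n) (hk : 3 ≤ k) {e : ℝ}
    (h1 : alpha (n + k) n * n * k ≤ e) (h2 : e ≤ n * k) :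
    n * k + (n + k - 2) * e + 2 * (e ^ 2 - (alpha (n + k) n * n * k) ^ 2) ≤
      alpha (n + k) n * n * k * e := by
  obtain ⟨ha, ha1, hspec⟩ := alpha_spec (by omega : 1 ≤ n) (by omega : 1 ≤ k)
  set a := alpha (n + k) n
  have hn' : (3 : ℝ) ≤ n := by exact_mod_cast hn
  have hk' : (3 : ℝ) ≤ k := by exact_mod_cast hk
  have hmul : ((min n k : ℕ) : ℝ) * (max n k : ℕ) = n * k := by exact_mod_cast min_mul_max n k
  have hadd : ((min n k : ℕ) : ℝ) + (max n k : ℕ) = n + k := by exact_mod_cast min_add_max n k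
  have hr : (3 : ℝ) ≤ (min n k : ℕ) := by exact_mod_cast le_min hn hk
  have hrs : ((min n k : ℕ) : ℝ) ≤ (max n k : ℕ) := by exact_mod_cast min_le_max
  set r : ℝ := ((min n k : ℕ) : ℝ)
  set s : ℝ := ((max n k : ℕ) : ℝ)
  have hb : 0 ≤ 1 - a := by linarith
  have hab : a * (1 - a) * (9 * (r * s)) ≤ (r - 1) * (s - 1) := by
    have h3 : 9 * (r * s) ≤ r ^ 3 * s := by
      have h4 : 9 ≤ r ^ 2 := by nlinarith
      have h5 := mul_le_mul_of_nonneg_right h4 (by nlinarith : 0 ≤ r * s)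
      linarith
    have h4 := mul_le_mul_of_nonneg_left h3 (mul_nonneg (by linarith : 0 ≤ a) hb)
    have h5 : (r - 1) * (s - r + 1) ≤ (r - 1) * (s - 1) :=
      mul_le_mul_of_nonneg_left (by linarith) (by linarith)
    linarith
  have hrs0 : 0 < r * s := by nlinarith
  have ha2 : 2 / 3 ≤ a := by
    have h3 : a * (1 - a) * 9 ≤ 1 := by
      refine le_of_mul_le_mul_right ?_ hrs0
      nlinarith
    nlinarith
  have hgap : 5 * (1 - a) * (r * s) ≤ (r - 1) * (s - 1) := by
    have h3 : 2 / 3 * ((1 - a) * (9 * (r * s))) ≤ a * ((1 - a) * (9 * (r * s))) :=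
      mul_le_mul_of_nonneg_right ha2 (mul_nonneg hb (by linarith))
    have h4 := mul_nonneg hb hrs0.le
    linarith
  rw [hmul] at hgap hrs0
  have hprod : (r - 1) * (s - 1) = (n - 1) * (k - 1) := by linarith
  rw [hprod] at hgap
  have hT : 0 < a * n * k := by
    rw [mul_assoc]
    exact mul_pos (by linarith) hrs0
  set T := a * n * k with hTdef
  have hTa : T = a * (n * k) := by rw [hTdef, mul_assoc]
  set X : ℝ := n * k with hX
  -- value at `e = T`
  have hlow : X + (n + k - 2) * T ≤ T ^ 2 := by
    have h3 : X ≤ 2 * T := by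
      rw [hTa]
      nlinarith
    have h4 : (n : ℝ) + k ≤ T := by
      rw [hTa]
      nlinarith
    nlinarith
  -- value at `e = n k`
  have hhigh : X + (n + k - 2) * X + 2 * (X ^ 2 - T ^ 2) ≤ T * X := by
    have h3 : 1 + (n + k - 2) + 2 * (X - a ^ 2 * X) ≤ a * X := by
      nlinarith [mul_nonneg (mul_nonneg hb hb) hrs0.le]
    have h4 := mul_le_mul_of_nonneg_right h3 hrs0.le
    rw [hTa]
    linarith
  rcases h2.eq_or_lt with h3 | h3
  · rw [h3]
    exact hhigh
  · have hTX : 0 < X - T := by linarith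
    have h4 := mul_le_mul_of_nonneg_left hlow (by linarith : 0 ≤ X - e)
    have h5 := mul_le_mul_of_nonneg_left hhigh (by linarith : 0 ≤ e - T)
    have h6 : 0 ≤ (X - e) * (e - T) * (X - T) :=
      mul_nonneg (mul_nonneg (by linarith) (by linarith)) hTX.le
    refine le_of_mul_le_mul_left ?_ hTX
    linarith

/-- For `r = 2` and `m = k + 2`, the number `c = 1 / (1 + T)` is as `exists_frameBound_pair` needs
it. -/
theorem pair_root {k : ℕ} (hk : 1 ≤ k) {a : ℝ} (ha : 1 / 2 ≤ a)
    (hspec : a * (1 - a) * (2 ^ 3 * k) = (2 - 1) * (k - 2 + 1)) :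
    1 / (1 + 2 * a * k) * (k + 2) ≤ 1 ∧
      2 - 4 * (k + 2 - 1) * (1 / (1 + 2 * a * k)) +
        (k + 2) * (k + 2 - 1) * (1 / (1 + 2 * a * k)) ^ 2 = 0 := by
  have hk' : (1 : ℝ) ≤ k := by exact_mod_cast hk
  set T := 2 * a * k with hT
  have hquad : T ^ 2 - 2 * k * T + k * (k - 1) / 2 = 0 := by
    have h1 : T ^ 2 - 2 * k * T = - (k / 2) * (a * (1 - a) * (2 ^ 3 * k)) := by
      rw [hT]
      ring
    rw [h1, hspec]
    ring
  have hTk : k ≤ T := by nlinarith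
  have hTk1 : k + 1 ≤ T := by nlinarith
  have hpos : 0 < 1 + T := by linarith
  constructor
  · rw [one_div_mul_eq_div, div_le_one hpos]
    linarith
  · field_simp
    linarith

theorem exists_frameBound {n k : ℕ} (hn : 1 ≤ n) (hk : 1 ≤ k)
    {A : Matrix (Fin n) (Fin (n + k)) ℝ} (hA : A * Aᵀ = 1) :
    ∃ S : Finset (Fin (n + k)), S.card = n ∧
      FrameBound A (1 / (1 + alpha (n + k) n * n * k)) S := by
  obtain ⟨ha, -, hspec⟩ := alpha_spec hn hk
  have hn' : (1 : ℝ) ≤ n := by exact_mod_cast hn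
  have hk' : (1 : ℝ) ≤ k := by exact_mod_cast hk
  have hT : 0 ≤ alpha (n + k) n * n * k := by positivity
  have hK : ((n + k : ℕ) : ℝ) - n = k := by
    push_cast
    ring
  by_cases hbig : 3 ≤ n ∧ 3 ≤ k
  · exact exists_frameBound_of_exchange hA rfl hK hT fun e h1 h2 =>
      exchange_inequality hbig.1 hbig.2 h1 h2
  by_cases hone : min n k = 1
  · -- here `α = 1`, so `T = n k` and `T ≤ e ≤ n k` leaves only `e = T`
    have ha' : alpha (n + k) n = 1 := by
      rw [hone] at hspec
      have hs : (1 : ℝ) ≤ (max n k : ℕ) := by exact_mod_cast hn.trans (le_max_left n k)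
      have h1 : (1 - alpha (n + k) n) * (alpha (n + k) n * (max n k : ℕ)) = 0 := by
        push_cast at hspec ⊢
        linarith
      have h2 : alpha (n + k) n * ((max n k : ℕ) : ℝ) ≠ 0 :=
        (mul_pos (by linarith) (by linarith)).ne'
      linarith [(mul_eq_zero.1 h1).resolve_right h2]
    refine exists_frameBound_of_exchange hA rfl hK hT fun e h1 h2 => ?_
    rw [ha', one_mul] at h1 ⊢
    rw [le_antisymm h2 h1]
    nlinarith [mul_nonneg (mul_nonneg (sub_nonneg.2 hn') (sub_nonneg.2 hk'))
      (by positivity : (0 : ℝ) ≤ n * k)]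
  by_cases hn2 : n = 2
  · subst hn2
    have h2k : 2 ≤ k := by omega
    rw [min_eq_left h2k, max_eq_right h2k] at hspec
    obtain ⟨h1, h2⟩ := pair_root hk ha (by exact_mod_cast hspec)
    have e : (1 : ℝ) + alpha (2 + k) 2 * (2 : ℕ) * k = 1 + 2 * alpha (2 + k) 2 * k := by
      push_cast
      ring
    rw [e]
    refine exists_frameBound_pair hA (by omega) (by positivity) ?_ ?_
    · push_cast
      rwa [add_comm (2 : ℝ)]
    · push_cast
      rw [add_comm (2 : ℝ) (k : ℝ), h2]
  · have hk2 : k = 2 := by omega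
    subst hk2
    have h2n : 2 ≤ n := by omega
    rw [min_eq_right h2n, max_eq_left h2n] at hspec
    obtain ⟨h1, h2⟩ := pair_root hn ha (by exact_mod_cast hspec)
    have e : (1 : ℝ) + alpha (n + 2) n * n * (2 : ℕ) = 1 + 2 * alpha (n + 2) n * n := by
      push_cast
      ring
    rw [e]
    obtain ⟨A', hA', hAA'⟩ := exists_complement hA rfl
    obtain ⟨S, hS, hframe⟩ := exists_frameBound_pair hA' (by omega)
      (by positivity : 0 < 1 / (1 + 2 * alpha (n + 2) n * n)) (by push_cast; exact h1)
      (by push_cast; exact h2.ge)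
    refine ⟨Sᶜ, ?_, hframe.compl hA hA' hAA' (by positivity) ?_ hS⟩
    · rw [Finset.card_compl, hS, Fintype.card_fin]
      omega
    · rw [div_le_one (by positivity)]
      have : 0 ≤ 2 * alpha (n + 2) n * n := by positivity
      linarith

end SubsetSelection

theorem corollary1p4 (n m : ℕ) (hn : 1 ≤ n) (hm : n + 1 ≤ m)
    (A : Matrix (Fin n) (Fin m) ℝ) (hA : A * A.transpose = 1) :
    (∃ S₀ : Finset (Fin m), S₀.card = n ∧
      LinearIndependent ℝ (fun j : S₀ => A.col j) ∧
      Submodule.span ℝ (Set.range fun j : S₀ => A.col j) = ⊤ ∧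
      SubsetSelection.sigmaMin (SubsetSelection.colSubmatrix A S₀) ^ 2 ≥
        1 / (SubsetSelection.alpha m n * n * ((m : ℝ) - n) + 1)) ∧
    (2 ≤ n → n + 2 ≤ m →
      0 < SubsetSelection.alpha m n ∧ SubsetSelection.alpha m n < 1 ∧
      1 / ((n : ℝ) * ((m : ℝ) - n) + 1) <
        1 / (SubsetSelection.alpha m n * n * ((m : ℝ) - n) + 1)) := by
  obtain ⟨k, rfl⟩ := Nat.exists_eq_add_of_le (Nat.le_of_succ_le hm)
  have hk : 1 ≤ k := by omega
  have hK : ((n + k : ℕ) : ℝ) - n = k := by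
    push_cast
    ring
  have ha : 0 < SubsetSelection.alpha (n + k) n :=
    lt_of_lt_of_le (by norm_num) (SubsetSelection.alpha_spec hn hk).1
  rw [hK]
  refine ⟨?_, fun hn2 hm2 => ?_⟩
  · obtain ⟨S, hS, h⟩ := SubsetSelection.exists_frameBound hn hk hA
    rw [add_comm 1] at h
    have hc : 0 < 1 / (SubsetSelection.alpha (n + k) n * n * k + 1) := by positivity
    exact ⟨S, hS, h.linearIndependent hc hS, h.span_eq_top hc hS hn, h.le_sigmaMin_sq hc hS hn⟩
  · have ha1 := SubsetSelection.alpha_lt_one hn2 (by omega : 2 ≤ k)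
    refine ⟨ha, ha1, one_div_lt_one_div_of_lt (by positivity) ?_⟩
    have hpos : (0 : ℝ) < n * k := by positivity
    nlinarith
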